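/- Let $(E,[\![\cdot,\cdot]\!],\rho)$ be a Lie algebroid of finite rank over a (Hausdorff, finite-dimensional) smooth manifold $Q$, with dual bundle $E^*$, and let $\pi: E^*\times\mathbb R\to Q$ be the projection. Let $\mathcal T^E(E^*\times\mathbb R)$ be the prolongation of $E$ over $\pi$: the Lie algebroid over $E^*\times\mathbb R$ whose fibre at $p$ is $\{(a,v)\in E_{\pi(p)}\times T_p(E^*\times\mathbb R) : \rho(a)=T\pi(v)\}$, whose anchor is $\rho^{\pi}(a,v)=v$, and whose bracket is determined by the Leibniz rule and $[\![(\sigma_1\circ\pi,X_1),(\sigma_2\circ\pi,X_2)]\!]^{\pi}=([\![\sigma_1,\sigma_2]\!]\circ\pi,[X_1,X_2])$ for $\sigma_i\in\mathrm{Sec}(E)$ and vector fields $X_i$ on $E^*\times\mathbb R$ that are $\pi$-related to $\rho(\sigma_i)$. Let $d$ be its exterior differential, and let $\eta$ be its contact $1$-section $\eta_{(b,s)}(a,v)=ds(v)-b(a)$, with Reeb section $\mathcal R$ (the section with $i_{\mathcal R}d\eta=0$, $i_{\mathcal R}\eta=1$). For a smooth function $H:E^*\times\mathbb R\to\mathbb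 R$ let $\xi_H$ be the Hamiltonian section, i.e. the section of $\mathcal T^E(E^*\times\mathbb R)$ determined by $$i_{\xi_H}\eta=-H,\qquad i_{\xi_H}d\eta=dH-\rho^{\pi}(\mathcal R)(H)\,\eta .$$ Let $\gamma=(\gamma_0,\gamma_s):Q\to E^*\times\mathbb R$ be a smooth section of $\pi$ and let $F_\gamma=\{(a,T\gamma(\rho(a))) : a\in E\}$, which is a Lie subalgebroid of $\mathcal T^E(E^*\times\mathbb R)$ over the submanifold $\gamma(Q)$. Suppose that $F_\gamma$ is Legendrian, i.e. $\operatorname{rank}\mathcal T^E(E^*\times\mathbb R)=2\operatorname{rank}F_\gamma+1$ and $\eta$ vanishes on $F_\gamma$. Then $\gamma$ is locally the $1$-jet $j^1f=(d^Ef,f)$ of a function $f$ on $Q$, where $d^Ef(a)=\rho(a)f$. Moreover, let $\xi_H^\gamma=\mathrm{pr}_1\circ\xi_H\circ\gamma\in\mathrm{Sec}(E)$. Then $\xi_H$ and $\xi_H^\gamma$ are $\gamma$-related, that is, $$\xi_H(\gamma(q))=\bigl(\xi_H^\gamma(q),\,T_q\gamma(\rho(\xi_H^\gamma(q)))\bigr)\quad\text{for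 all }q\in Q,$$ if and only if the Hamilton--Jacobi equation $H\circ\gamma=0$ holds on $Q$. -/

import Mathlib

open Bundle Set Filter Topology
open scoped Manifold ContDiff Bundle

noncomputable section

set_option linter.unusedSectionVars false

namespace ContactAlgebroid

/-- Derivative of a vector-valued function `f` on a manifold at `x` along the tangent vector `v`. -/
def dirDeriv {EM HM M W : Type*} [NormedAddCommGroup EM] [NormedSpace ℝ EM]
    [TopologicalSpace HM] (I : ModelWithCorners ℝ EM HM) [TopologicalSpace M] [ChartedSpace HM M]
    [NormedAddCommGroup W] [NormedSpace ℝ W] (f : M → W) (x : M) (v : TangentSpace I x) : W :=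
  mfderiv I 𝓘(ℝ, W) f x v

section Algebroid

variable {B : Type*} [NormedAddCommGroup B] [NormedSpace ℝ B]
  {Q : Type*} [TopologicalSpace Q] [ChartedSpace B Q]
  {F : Type*} [NormedAddCommGroup F] [NormedSpace ℝ F]
  {E : Q → Type*} [∀ q, AddCommGroup (E q)] [∀ q, Module ℝ (E q)] [∀ q, TopologicalSpace (E q)]
  [TopologicalSpace (TotalSpace F E)] [FiberBundle F E] [VectorBundle ℝ F E]

/-- The section `f • σ` of `E`, for a smooth function `f` and a smooth section `σ`. -/
def smulSection (f : C^∞⟮𝓘(ℝ, B), Q; 𝓘(ℝ, ℝ), ℝ⟯) (σ : Cₛ^∞⟮𝓘(ℝ, B); F, E⟯) :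
    Cₛ^∞⟮𝓘(ℝ, B); F, E⟯ :=
  ⟨fun q ↦ f q • σ q, f.contMDiff.smul_section σ.contMDiff⟩

variable (B F E) in
/-- A Lie algebroid structure on the smooth vector bundle `E → Q` (with typical fibre `F`, over the
manifold `Q` modelled on `B`): a smooth vector bundle map `ρ : E → TQ` over the identity (the
anchor), and a real Lie bracket on the smooth sections of `E`, subject to the Leibniz rule
`⟦σ, f τ⟧ = f ⟦σ, τ⟧ + (ρ(σ) f) τ`. -/
structure LieAlgebroid [IsManifold 𝓘(ℝ, B) ∞ Q] where
  anchor : ∀ q : Q, E q →ₗ[ℝ] TangentSpace 𝓘(ℝ, B) q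
  contMDiff_anchor : ContMDiff (𝓘(ℝ, B).prod 𝓘(ℝ, F)) 𝓘(ℝ, B).tangent ∞
    (fun a : TotalSpace F E ↦ (⟨a.proj, anchor a.proj a.snd⟩ : TangentBundle 𝓘(ℝ, B) Q))
  bracket : Cₛ^∞⟮𝓘(ℝ, B); F, E⟯ → Cₛ^∞⟮𝓘(ℝ, B); F, E⟯ → Cₛ^∞⟮𝓘(ℝ, B); F, E⟯
  bracket_add_right : ∀ σ τ₁ τ₂, bracket σ (τ₁ + τ₂) = bracket σ τ₁ + bracket σ τ₂
  bracket_smul_right : ∀ (c : ℝ) (σ τ), bracket σ (c • τ) = c • bracket σ τ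
  bracket_skew : ∀ σ τ, bracket σ τ = -bracket τ σ
  jacobi : ∀ σ₁ σ₂ σ₃, bracket σ₁ (bracket σ₂ σ₃) + bracket σ₂ (bracket σ₃ σ₁)
    + bracket σ₃ (bracket σ₁ σ₂) = 0
  leibniz : ∀ (f : C^∞⟮𝓘(ℝ, B), Q; 𝓘(ℝ, ℝ), ℝ⟯) (σ τ) (q : Q),
    bracket σ (smulSection f τ) q =
      f q • bracket σ τ q + dirDeriv 𝓘(ℝ, B) f q (anchor q (σ q)) • τ q

/-- Every vector `a ∈ E_q` extends to a smooth global section of `E` which, near `q`, is constant in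
the preferred trivialization of `E` at `q`. -/
theorem exists_constSection [FiniteDimensional ℝ B] [T2Space Q] [IsManifold 𝓘(ℝ, B) ∞ Q]
    [ContMDiffVectorBundle ∞ F E 𝓘(ℝ, B)] (q : Q) (a : E q) :
    ∃ s : Cₛ^∞⟮𝓘(ℝ, B); F, E⟯, ∀ᶠ x in 𝓝 q,
      s x = (trivializationAt F E q).symm x ((trivializationAt F E q) ⟨q, a⟩).2 := by
  set e := trivializationAt F E q with he
  have hq : e.baseSet ∈ 𝓝 q :=
    e.open_baseSet.mem_nhds (FiberBundle.mem_baseSet_trivializationAt' q)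
  obtain ⟨χ, -, hχ⟩ :=
    (SmoothBumpFunction.nhds_basis_tsupport (I := 𝓘(ℝ, B)) q).mem_iff.1 hq
  have hs : ContMDiffOn 𝓘(ℝ, B) (𝓘(ℝ, B).prod 𝓘(ℝ, F)) ∞
      (fun x ↦ (⟨x, e.symm x (e ⟨q, a⟩).2⟩ : TotalSpace F E)) e.baseSet := by
    rw [e.contMDiffOn_section_baseSet_iff]
    refine (contMDiffOn_const (c := (e ⟨q, a⟩).2)).congr fun y hy ↦ ?_
    simp [e.apply_mk_symm hy]
  refine ⟨⟨fun x ↦ χ x • e.symm x (e ⟨q, a⟩).2,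
    ContMDiffOn.smul_section_of_tsupport (s := fun x ↦ e.symm x (e ⟨q, a⟩).2)
      χ.contMDiff.contMDiffOn e.open_baseSet hχ hs⟩, ?_⟩
  filter_upwards [χ.eventuallyEq_one] with x hx
  change χ x • (e.symm x (e ⟨q, a⟩).2 : E x) = _
  rw [hx]; simp

/-- A chosen smooth extension of `a ∈ E_q` to a global section of `E` that is constant near `q` in
the preferred trivialization of `E` at `q`, as in `exists_constSection`. If `(e_α)` is the frame of
that trivialization and `a = a^α e_α(q)`, it coincides with `a^α e_α` near `q`. -/
def constSection [FiniteDimensional ℝ B] [T2Space Q] [IsManifold 𝓘(ℝ, B) ∞ Q]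
    [ContMDiffVectorBundle ∞ F E 𝓘(ℝ, B)] (q : Q) (a : E q) : Cₛ^∞⟮𝓘(ℝ, B); F, E⟯ :=
  (exists_constSection q a).choose

section Prolongation

variable {EP : Type*} [NormedAddCommGroup EP] [NormedSpace ℝ EP] {HP : Type*} [TopologicalSpace HP]
  (IP : ModelWithCorners ℝ EP HP) {P : Type*} [TopologicalSpace P] [ChartedSpace HP P]
  [IsManifold 𝓘(ℝ, B) ∞ Q] (A : LieAlgebroid B F E) (prj : P → Q)

/-- The fibre at `p` of the prolongation `𝒯^E P` of `E` over `prj : P → Q`: the pairs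
`(a, v) ∈ E_{prj(p)} × T_p P` with `ρ(a) = Tprj(v)`. -/
def prolFiber (p : P) : Submodule ℝ (E (prj p) × TangentSpace IP p) where
  carrier := {z | A.anchor (prj p) z.1 = mfderiv IP 𝓘(ℝ, B) prj p z.2}
  add_mem' {z w} hz hw := by
    simp only [Set.mem_ofPred_eq] at hz hw
    simp [hz, hw]
  zero_mem' := by simp
  smul_mem' c z hz := by
    simp only [Set.mem_ofPred_eq] at hz
    simp [hz]

/-- A smooth section `Z = (σ, X)` of `𝒯^E P → P`. As `𝒯^E P` is a submanifold of `E × TP`,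
smoothness is smoothness of the two components `P → E` and `P → TP`. -/
structure ProlSection [IsManifold IP ∞ P] where
  toFun : ∀ p : P, prolFiber IP A prj p
  contMDiff_fst : ContMDiff IP (𝓘(ℝ, B).prod 𝓘(ℝ, F)) ∞
    (fun p ↦ (⟨prj p, (toFun p).1.1⟩ : TotalSpace F E))
  contMDiff_snd : ContMDiff IP IP.tangent ∞
    (fun p ↦ (⟨p, (toFun p).1.2⟩ : TangentBundle IP P))

variable {IP A prj} [IsManifold IP ∞ P]

/-- The `E`-component `pr₁ ∘ Z` of a section of the prolongation. -/
def ProlSection.fst (Z : ProlSection IP A prj) (p : P) : E (prj p) := (Z.toFun p).1.1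

/-- The vector field `ρ^π(Z)` on `P` (the anchor of the prolongation is the second projection). -/
def ProlSection.vec (Z : ProlSection IP A prj) (p : P) : TangentSpace IP p := (Z.toFun p).1.2

/-- The derivative at `p`, along `v ∈ T_p P`, of the `E`-component of `Z`, computed with the
coefficients of `Z` in the frame of the preferred trivialization of `E` at `prj(p)`: writing
`pr₁ ∘ Z = Z^α (e_α ∘ prj)` near `p`, this is `v(Z^α) e_α(prj(p))`. -/
def ProlSection.derivFst (Z : ProlSection IP A prj) (p : P) (v : TangentSpace IP p) : E (prj p) :=
  (trivializationAt F E (prj p)).symm (prj p)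
    (dirDeriv IP (fun p' ↦ (trivializationAt F E (prj p) ⟨prj p', Z.fst p'⟩).2) p v)

/-- The Lie bracket of two sections `Z₁, Z₂` of the prolongation. Its `TP`-component is the bracket
of the vector fields `ρ^π(Z₁), ρ^π(Z₂)`. Its `E`-component at `p` is
`Z₁^α Z₂^β ⟦e_α, e_β⟧ + ρ^π(Z₁)(Z₂^α) e_α - ρ^π(Z₂)(Z₁^α) e_α`, where `(e_α)` is a local frame of `E`
near `prj(p)` and `pr₁ ∘ Zᵢ = Zᵢ^α (e_α ∘ prj)`; this is the Leibniz extension of the relations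
`⟦𝒳_α, 𝒳_β⟧ = 𝒞^γ_{αβ} 𝒳_γ`, `⟦𝒳_α, 𝒱_ℓ⟧ = 0`, `⟦𝒱_ℓ, 𝒱_φ⟧ = 0`.
It is recorded as an element of `E_{prj(p)} × T_p P`, which contains the fibre of `𝒯^E P`. -/
def prolBracket [FiniteDimensional ℝ B] [T2Space Q] [ContMDiffVectorBundle ∞ F E 𝓘(ℝ, B)]
    (Z₁ Z₂ : ProlSection IP A prj) (p : P) : E (prj p) × TangentSpace IP p :=
  (A.bracket (constSection (prj p) (Z₁.fst p)) (constSection (prj p) (Z₂.fst p)) (prj p)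
      + Z₂.derivFst p (Z₁.vec p) - Z₁.derivFst p (Z₂.vec p),
    VectorField.mlieBracket IP Z₁.vec Z₂.vec p)

/-- The exterior differential of a `1`-section `μ` of the prolongation, evaluated on two sections:
`dμ(Z₁, Z₂) = ρ^π(Z₁)(μ(Z₂)) - ρ^π(Z₂)(μ(Z₁)) - μ(⟦Z₁, Z₂⟧)`. -/
def extDerivOne [FiniteDimensional ℝ B] [T2Space Q] [ContMDiffVectorBundle ∞ F E 𝓘(ℝ, B)]
    (μ : ∀ p : P, (E (prj p) × TangentSpace IP p) →ₗ[ℝ] ℝ) (Z₁ Z₂ : ProlSection IP A prj) (p : P) : ℝ :=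
  dirDeriv IP (fun p' ↦ μ p' (Z₂.toFun p')) p (Z₁.vec p)
    - dirDeriv IP (fun p' ↦ μ p' (Z₁.toFun p')) p (Z₂.vec p)
    - μ p (prolBracket Z₁ Z₂ p)

variable (A) in
/-- Let `η` be a `1`-section of `𝒯^E P`, regarded as a contact algebroid of rank `2k + 1`. A
subalgebroid `S` of `𝒯^E P` along `i : N → P` is Legendrian if `S` has rank `k` and `η` vanishes on
`S`. (Closure under the algebroid structure does not enter: the predicate is used below for a
subbundle which is the image of an algebroid morphism.) -/
def IsLegendrian (η : ∀ p : P, (E (prj p) × TangentSpace IP p) →ₗ[ℝ] ℝ) {N : Type*} (i : N → P)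
    (S : ∀ x : N, Submodule ℝ (prolFiber IP A prj (i x))) : Prop :=
  ∀ x : N, 2 * Module.finrank ℝ (S x) + 1 = Module.finrank ℝ (prolFiber IP A prj (i x)) ∧
    ∀ z ∈ S x, η (i x) z = 0

end Prolongation

section Hamiltonian

variable (B F E) in
/-- The manifold `E^* × ℝ`. -/
abbrev DualLine : Type _ := TotalSpace (F →L[ℝ] ℝ) (fun q ↦ E q →L[ℝ] ℝ) × ℝ

variable (B F) in
/-- The model with corners of `E^* × ℝ`. -/
abbrev dualLineModel : ModelWithCorners ℝ ((B × (F →L[ℝ] ℝ)) × ℝ)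
    (ModelProd (ModelProd B (F →L[ℝ] ℝ)) ℝ) :=
  (𝓘(ℝ, B).prod 𝓘(ℝ, F →L[ℝ] ℝ)).prod 𝓘(ℝ, ℝ)

/-- The projection `E^* × ℝ → Q`. -/
abbrev dualLineProj (p : DualLine F E) : Q := p.1.proj

variable [∀ q, IsTopologicalAddGroup (E q)] [∀ q, ContinuousSMul ℝ (E q)]
  [IsManifold 𝓘(ℝ, B) ∞ Q] [ContMDiffVectorBundle ∞ F E 𝓘(ℝ, B)]
  (A : LieAlgebroid B F E)

/-- The fibre at `p` of the contact Hamiltonian prolongation `𝒯^E(E^* × ℝ)`. -/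
abbrev HamFiber (p : DualLine F E) : Type _ := prolFiber (dualLineModel B F) A dualLineProj p

/-- The smooth sections of `𝒯^E(E^* × ℝ) → E^* × ℝ`. -/
abbrev HamSection : Type _ :=
  ProlSection (dualLineModel B F) A (dualLineProj : DualLine F E → Q)

variable (B) in
/-- The Liouville `1`-section `Θ_{(b, s)}(a, v) = b(a)`. -/
def liouville (p : DualLine F E) :
    (E (dualLineProj p) × TangentSpace (dualLineModel B F) p) →ₗ[ℝ] ℝ :=
  (p.1.snd : E p.1.proj →ₗ[ℝ] ℝ).comp (LinearMap.fst ℝ _ _)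

variable (B) in
/-- The contact `1`-section `η = 𝒱^s - Θ`, where `𝒱^s(a, v) = ds(v)`, for `s : E^* × ℝ → ℝ` the
second projection. -/
def contactForm (p : DualLine F E) :
    (E (dualLineProj p) × TangentSpace (dualLineModel B F) p) →ₗ[ℝ] ℝ :=
  (mfderiv (dualLineModel B F) 𝓘(ℝ, ℝ) (fun p' : DualLine F E ↦ p'.2) p).toLinearMap.comp
      (LinearMap.snd ℝ _ _)
    - liouville B p

variable {A}

/-- `R` is the Reeb section of `(𝒯^E(E^* × ℝ), η)`: `i_R dη = 0` and `i_R η = 1`. -/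
structure IsReebSection [FiniteDimensional ℝ B] [T2Space Q] (R : HamSection A) : Prop where
  extDeriv_eq : ∀ (Z : HamSection A) (p : DualLine F E), extDerivOne (contactForm B) R Z p = 0
  contactForm_eq : ∀ p : DualLine F E, contactForm B p (R.toFun p) = 1

/-- `ξ` is the Hamiltonian section of the function `H`, where `R` is the Reeb section:
`i_ξ η = -H` and `i_ξ dη = dH - ρ(R)(H) η`. -/
structure IsHamiltonianSection [FiniteDimensional ℝ B] [T2Space Q]
    (R : HamSection A) (H : DualLine F E → ℝ) (ξ : HamSection A) : Prop where
  contactForm_eq : ∀ p : DualLine F E, contactForm B p (ξ.toFun p) = -H p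
  extDeriv_eq : ∀ (Z : HamSection A) (p : DualLine F E),
    extDerivOne (contactForm B) ξ Z p =
      dirDeriv (dualLineModel B F) H p (Z.vec p)
        - dirDeriv (dualLineModel B F) H p (R.vec p) * contactForm B p (Z.toFun p)

/-- The section `γ = (γ₀, γₛ) : Q → E^* × ℝ` given by a section `γ₀` of `E^*` and a function `γₛ`. -/
def gammaMap (γ₀ : Cₛ^∞⟮𝓘(ℝ, B); F →L[ℝ] ℝ, fun q ↦ E q →L[ℝ] ℝ⟯)
    (γₛ : C^∞⟮𝓘(ℝ, B), Q; 𝓘(ℝ, ℝ), ℝ⟯) (q : Q) : DualLine F E :=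
  (⟨q, γ₀ q⟩, γₛ q)

variable (A) (γ₀ : Cₛ^∞⟮𝓘(ℝ, B); F →L[ℝ] ℝ, fun q ↦ E q →L[ℝ] ℝ⟯)
  (γₛ : C^∞⟮𝓘(ℝ, B), Q; 𝓘(ℝ, ℝ), ℝ⟯)

theorem contMDiff_gammaMap : ContMDiff 𝓘(ℝ, B) (dualLineModel B F) ∞ (gammaMap γ₀ γₛ) :=
  γ₀.contMDiff.prodMk γₛ.contMDiff

theorem mfderiv_proj_gammaMap (q : Q) (v : TangentSpace 𝓘(ℝ, B) q) :
    mfderiv (dualLineModel B F) 𝓘(ℝ, B) (dualLineProj : DualLine F E → Q) (gammaMap γ₀ γₛ q)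
      (mfderiv 𝓘(ℝ, B) (dualLineModel B F) (gammaMap γ₀ γₛ) q v) = v := by
  have h₁ : MDifferentiableAt (dualLineModel B F) 𝓘(ℝ, B) (dualLineProj : DualLine F E → Q)
      (gammaMap γ₀ γₛ q) :=
    (((contMDiff_proj (n := ∞) (fun q ↦ E q →L[ℝ] ℝ)).comp contMDiff_fst).mdifferentiable
      (by simp)) _
  have h₂ : MDifferentiableAt 𝓘(ℝ, B) (dualLineModel B F) (gammaMap γ₀ γₛ) q :=
    (contMDiff_gammaMap γ₀ γₛ).mdifferentiable (by simp) q
  have h₃ := mfderiv_comp q h₁ h₂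
  have h₄ : (dualLineProj : DualLine F E → Q) ∘ gammaMap γ₀ γₛ = id := rfl
  rw [h₄, mfderiv_id] at h₃
  exact (DFunLike.congr_fun h₃ v).symm

/-- The map `(Id_E, Tγ ∘ ρ) : E_q → 𝒯^E(E^* × ℝ)_{γ(q)}`, `a ↦ (a, Tγ(ρ(a)))`. -/
def gammaLift (q : Q) : E q →ₗ[ℝ] HamFiber A (gammaMap γ₀ γₛ q) :=
  LinearMap.codRestrict (prolFiber (dualLineModel B F) A dualLineProj (gammaMap γ₀ γₛ q))
    (LinearMap.id.prod
      ((mfderiv 𝓘(ℝ, B) (dualLineModel B F) (gammaMap γ₀ γₛ) q).toLinearMap.comp (A.anchor q)))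
    (fun a ↦ (mfderiv_proj_gammaMap γ₀ γₛ q (A.anchor q a)).symm)

/-- The fibre at `γ(q)` of `F_γ = {(a, Tγ(ρ(a))) | a ∈ E}`, a subbundle of `𝒯^E(E^* × ℝ)` along the
submanifold `γ(Q)`, which is parametrized by `γ : Q → E^* × ℝ`. -/
def gammaSub (q : Q) : Submodule ℝ (HamFiber A (gammaMap γ₀ γₛ q)) :=
  LinearMap.range (gammaLift A γ₀ γₛ q)

/-- `γ = (γ₀, γₛ)` is locally the `1`-jet `j¹f = (d^E f, f)` of a function `f` on `Q`, where
`d^E f(a) = ρ(a) f`. -/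
def IsLocallyOneJet : Prop :=
  ∀ q₀ : Q, ∃ (U : Set Q) (f : Q → ℝ), IsOpen U ∧ q₀ ∈ U ∧ ContMDiffOn 𝓘(ℝ, B) 𝓘(ℝ, ℝ) ∞ f U ∧
    ∀ q ∈ U, γₛ q = f q ∧ ∀ a : E q, γ₀ q a = dirDeriv 𝓘(ℝ, B) f q (A.anchor q a)

variable {A}

/-- The section `ξ^γ = pr₁ ∘ ξ ∘ γ` of `E` induced by a section `ξ` of `𝒯^E(E^* × ℝ)`. -/
def inducedSection (ξ : HamSection A) : Cₛ^∞⟮𝓘(ℝ, B); F, E⟯ where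
  toFun q := (ξ.toFun (gammaMap γ₀ γₛ q)).1.1
  contMDiff_toFun := ξ.contMDiff_fst.comp (contMDiff_gammaMap γ₀ γₛ)

/-- `ξ` and the section `σ` of `E` are `γ`-related: `ξ ∘ γ = (Id_E, Tγ ∘ ρ) ∘ σ`. -/
def GammaRelated (ξ : HamSection A) (σ : Cₛ^∞⟮𝓘(ℝ, B); F, E⟯) : Prop :=
  ∀ q : Q, ξ.toFun (gammaMap γ₀ γₛ q) = gammaLift A γ₀ γₛ q (σ q)

end Hamiltonian

end Algebroid

end ContactAlgebroid

end

noncomputable section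

set_option linter.unusedSectionVars false

namespace ContactAlgebroid

/-! ### Calculus in a Lie algebroid: the anchor respects brackets. -/

section Algebroid

variable {B : Type*} [NormedAddCommGroup B] [NormedSpace ℝ B]
  {Q : Type*} [TopologicalSpace Q] [ChartedSpace B Q]
  {F : Type*} [NormedAddCommGroup F] [NormedSpace ℝ F]
  {E : Q → Type*} [∀ q, AddCommGroup (E q)] [∀ q, Module ℝ (E q)] [∀ q, TopologicalSpace (E q)]
  [TopologicalSpace (TotalSpace F E)] [FiberBundle F E] [VectorBundle ℝ F E]
  [IsManifold 𝓘(ℝ, B) ∞ Q]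

/-! Write `γ̂(a) = (a, Tγ(ρ(a)))` for `gammaLift`. Since `η(γ̂(a)) = ρ(a)γₛ - γ₀(a)`, the vanishing
of `η` on `F_γ` says exactly `γ₀ = d^E γₛ`, so `f = γₛ` works, even globally. If `ξ_H` is
`γ`-related to `ξ_H^γ`, then `ξ_H ∘ γ` lies in `F_γ`, and `-H ∘ γ = η(ξ_H ∘ γ) = 0`.

Conversely let `H ∘ γ = 0` and `a = ξ_H^γ(q)`. The difference `ξ_H(γ(q)) - γ̂(a)` has zero
`E`-component, hence is a vertical tangent vector, with a momentum part and an `s` part. Both terms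
have `η = 0`, which kills the `s` part. For every `a'`, `dη(ξ_H, γ̂(a'))` is the derivative of `H ∘
γ` along `ρ(a')`, hence zero, and `dη(γ̂(a), γ̂(a')) = 0` because `d^E d^E γₛ = 0`. Pairing a
vertical vector with `γ̂(a')` under `dη` gives minus its momentum part evaluated at `a'`, so that
part vanishes too.

The main ingredients are the pointwise formula for `dη` (`extDerivOne_contactForm`), the isotropy of
`F_γ` (`extDeriv_gammaLift_eq_zero`, resting on `LieAlgebroid.dirDeriv_anchor_bracket`) and the
extension of elements to sections (`exists_hamSection`). -/

theorem contMDiff_dirDeriv_section (f : C^∞⟮𝓘(ℝ, B), Q; 𝓘(ℝ, ℝ), ℝ⟯)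
    (X : ∀ q : Q, TangentSpace 𝓘(ℝ, B) q)
    (hX : ContMDiff 𝓘(ℝ, B) 𝓘(ℝ, B).tangent ∞ (fun q ↦ (⟨q, X q⟩ : TangentBundle 𝓘(ℝ, B) Q))) :
    ContMDiff 𝓘(ℝ, B) 𝓘(ℝ, ℝ) ∞ (fun q ↦ dirDeriv 𝓘(ℝ, B) f q (X q)) :=
  contMDiff_snd_tangentBundle_modelSpace (E := ℝ) (I := 𝓘(ℝ, ℝ)) |>.comp
    ((f.contMDiff.contMDiff_tangentMap (m := ∞) (by simp)).comp hX)

/-- The Lie derivative `ρ(σ) f` of a smooth function along a section of a Lie algebroid. -/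
def LieAlgebroid.lieDeriv (A : LieAlgebroid B F E) (σ : Cₛ^∞⟮𝓘(ℝ, B); F, E⟯)
    (f : C^∞⟮𝓘(ℝ, B), Q; 𝓘(ℝ, ℝ), ℝ⟯) : C^∞⟮𝓘(ℝ, B), Q; 𝓘(ℝ, ℝ), ℝ⟯ :=
  ⟨fun q ↦ dirDeriv 𝓘(ℝ, B) f q (A.anchor q (σ q)),
    contMDiff_dirDeriv_section f (fun q ↦ A.anchor q (σ q)) (A.contMDiff_anchor.comp σ.contMDiff)⟩

theorem LieAlgebroid.bracket_smulSection (A : LieAlgebroid B F E) (σ τ : Cₛ^∞⟮𝓘(ℝ, B); F, E⟯)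
    (f : C^∞⟮𝓘(ℝ, B), Q; 𝓘(ℝ, ℝ), ℝ⟯) :
    A.bracket σ (smulSection f τ) =
      smulSection f (A.bracket σ τ) + smulSection (A.lieDeriv σ f) τ := by
  ext q
  exact A.leibniz f σ τ q

theorem LieAlgebroid.bracket_bracket (A : LieAlgebroid B F E) (σ τ ν : Cₛ^∞⟮𝓘(ℝ, B); F, E⟯) :
    A.bracket (A.bracket σ τ) ν = A.bracket σ (A.bracket τ ν) - A.bracket τ (A.bracket σ ν) := by
  have h := A.jacobi σ τ ν
  have h₁ : A.bracket τ (A.bracket ν σ) = -A.bracket τ (A.bracket σ ν) := by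
    rw [A.bracket_skew ν σ, ← neg_one_smul ℝ, A.bracket_smul_right, neg_one_smul]
  rw [h₁, A.bracket_skew ν (A.bracket σ τ)] at h
  rw [← sub_eq_zero, ← neg_eq_zero, ← h]
  abel

/-- The anchor of a Lie algebroid is a morphism of Lie algebras. -/
theorem LieAlgebroid.dirDeriv_anchor_bracket (A : LieAlgebroid B F E)
    (σ τ ν : Cₛ^∞⟮𝓘(ℝ, B); F, E⟯) (f : C^∞⟮𝓘(ℝ, B), Q; 𝓘(ℝ, ℝ), ℝ⟯) (q : Q) (hν : ν q ≠ 0) :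
    dirDeriv 𝓘(ℝ, B) f q (A.anchor q (A.bracket σ τ q)) =
      dirDeriv 𝓘(ℝ, B) (A.lieDeriv τ f) q (A.anchor q (σ q)) -
        dirDeriv 𝓘(ℝ, B) (A.lieDeriv σ f) q (A.anchor q (τ q)) := by
  -- Expand the Jacobi identity for `σ, τ, f ν` by Leibniz. The mixed terms cancel and `f` times the
  -- identity for `ν` drops out. What remains is the claimed identity multiplied by `ν q`, which is
  -- nonzero.
  have h := A.bracket_bracket σ τ (smulSection f ν)
  have h₀ := A.bracket_bracket σ τ ν
  simp only [A.bracket_smulSection, A.bracket_add_right] at h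
  have h' := congrArg (fun s : Cₛ^∞⟮𝓘(ℝ, B); F, E⟯ ↦ s q) h
  rw [h₀] at h'
  simp only [smulSection, LieAlgebroid.lieDeriv, ContMDiffSection.coe_add,
    ContMDiffSection.coe_sub, Pi.add_apply, Pi.sub_apply, ContMDiffMap.coeFn_mk,
    ContMDiffSection.coeFn_mk] at h' ⊢
  rw [← sub_eq_zero]
  refine (smul_eq_zero.1 ?_).resolve_right hν
  rw [sub_smul, sub_smul]
  rw [← sub_eq_zero] at h'
  rw [← h', smul_sub]
  abel

end Algebroid

/-! ### The Lie bracket of vector fields in a chart. -/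

section Manifold
open VectorField

variable {EM HM M W : Type*} [NormedAddCommGroup EM] [NormedSpace ℝ EM]
  [TopologicalSpace HM] {I : ModelWithCorners ℝ EM HM}
  [TopologicalSpace M] [ChartedSpace HM M] [IsManifold I ∞ M]
  [NormedAddCommGroup W] [NormedSpace ℝ W]

theorem mpullbackWithin_extChartAt_symm_apply (X : ∀ y : M, TangentSpace I y) {x y : M}
    (hy : y ∈ (extChartAt I x).source) :
    mpullbackWithin 𝓘(ℝ, EM) I (extChartAt I x).symm X (range I) (extChartAt I x y) =
      mfderiv I 𝓘(ℝ, EM) (extChartAt I x) y (X y) := by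
  have h₁ := mfderiv_extChartAt_comp_mfderivWithin_extChartAt_symm' (I := I) hy
  have h₂ := mfderivWithin_extChartAt_symm_comp_mfderiv_extChartAt' (I := I) hy
  have key : ∀ z : M, z = y → ∀ (T : EM →L[ℝ] TangentSpace I z) (S : TangentSpace I z →L[ℝ] EM),
      S ∘L T = .id ℝ _ → T ∘L S = .id ℝ _ → T.inverse (X z) = S (X z) := by
    intro z _ T S hST hTS
    rw [ContinuousLinearMap.inverse_eq hTS hST]
  have hz := (extChartAt I x).left_inv hy
  rw [mpullbackWithin_apply]
  -- The type of this derivative mentions the point `symm (chart y)`, which equals `y` only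
  -- propositionally; abstracting it allows the rewriting by `hz`.
  generalize mfderivWithin 𝓘(ℝ, EM) I (extChartAt I x).symm (range I) (extChartAt I x y) = T at *
  revert T
  rw [hz]
  intro T h₁ h₂
  exact key y rfl T _ h₁ h₂

/-- The derivation property of the Lie bracket, for a function that is linear in a chart. -/
theorem dirDeriv_mlieBracket_of_eventuallyEq_extChartAt [CompleteSpace EM] [I.Boundaryless]
    (L : EM →L[ℝ] W) (f : M → W) (x : M)
    (hf : f =ᶠ[𝓝 x] fun y ↦ L (extChartAt I x y)) (X Y : ∀ y : M, TangentSpace I y)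
    (hX : MDifferentiableAt I I.tangent (fun y ↦ (⟨y, X y⟩ : TangentBundle I M)) x)
    (hY : MDifferentiableAt I I.tangent (fun y ↦ (⟨y, Y y⟩ : TangentBundle I M)) x) :
    dirDeriv I f x (mlieBracket I X Y x) =
      dirDeriv I (fun y ↦ dirDeriv I f y (Y y)) x (X x) -
        dirDeriv I (fun y ↦ dirDeriv I f y (X y)) x (Y x) := by
  let loc (Z : ∀ y : M, TangentSpace I y) : EM → EM :=
    mpullbackWithin 𝓘(ℝ, EM) I (extChartAt I x).symm Z (range I)
  have hsrc : (extChartAt I x).source ∈ 𝓝 x := extChartAt_source_mem_nhds x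
  have hxs : x ∈ (extChartAt I x).source := mem_of_mem_nhds hsrc
  have hφd : ∀ y ∈ (extChartAt I x).source, MDifferentiableAt I 𝓘(ℝ, EM) (extChartAt I x) y :=
    fun y hy ↦ mdifferentiableAt_extChartAt (by rwa [extChartAt_source] at hy)
  -- Since `f` is `L` after the chart, `df(Z)` is `L` of the coordinate expression of `Z`. No second
  -- derivative of `f` arises, and the claim is `L` applied to the coordinate formula for the
  -- bracket.
  have hfd : ∀ᶠ y in 𝓝 x, ∀ v : TangentSpace I y,
      dirDeriv I f y v = L (mfderiv I 𝓘(ℝ, EM) (extChartAt I x) y v) := by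
    filter_upwards [hf.eventuallyEq_nhds, hsrc] with y hy hys v
    have h := mfderiv_comp y (g := L) L.differentiableAt.mdifferentiableAt (hφd y hys)
    rw [dirDeriv, hy.mfderiv_eq]
    refine (DFunLike.congr_fun h v).trans ?_
    rw [mfderiv_eq_fderiv, L.fderiv]
    rfl
  have hder : ∀ Z : ∀ y : M, TangentSpace I y,
      MDifferentiableAt I I.tangent (fun y ↦ (⟨y, Z y⟩ : TangentBundle I M)) x →
      ∀ v : TangentSpace I x, dirDeriv I (fun y ↦ dirDeriv I f y (Z y)) x v =
        L (fderiv ℝ (loc Z) (extChartAt I x x) (mfderiv I 𝓘(ℝ, EM) (extChartAt I x) x v)) := by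
    intro Z hZ v
    have hd : DifferentiableAt ℝ (loc Z) (extChartAt I x x) := by
      have h := (mdifferentiableWithinAt_univ.2 hZ).differentiableWithinAt_mpullbackWithin_vectorField
      rw [preimage_univ, univ_inter] at h
      exact h.differentiableAt (by rw [I.range_eq_univ]; exact univ_mem)
    have he : (fun y ↦ dirDeriv I f y (Z y)) =ᶠ[𝓝 x] (L ∘ loc Z) ∘ extChartAt I x := by
      filter_upwards [hfd, hsrc] with y hy hys
      rw [hy, ← mpullbackWithin_extChartAt_symm_apply Z hys]
      rfl
    have hLd := L.differentiableAt.comp (extChartAt I x x) hd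
    have h := mfderiv_comp x hLd.mdifferentiableAt (hφd x hxs)
    rw [dirDeriv, he.mfderiv_eq]
    refine (DFunLike.congr_fun h v).trans ?_
    rw [mfderiv_eq_fderiv, fderiv_comp _ L.differentiableAt hd, L.fderiv]
    rfl
  have hbr : mfderiv I 𝓘(ℝ, EM) (extChartAt I x) x (mlieBracket I X Y x) =
      lieBracket ℝ (loc X) (loc Y) (extChartAt I x x) := by
    refine ((isInvertible_mfderiv_extChartAt hxs).self_apply_inverse _).trans ?_
    change lieBracketWithin ℝ (loc X) (loc Y) _ _ = _
    rw [I.range_eq_univ, preimage_univ, univ_inter, lieBracketWithin_univ]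
  rw [hfd.self_of_nhds, hder Y hY, hder X hX, ← mpullbackWithin_extChartAt_symm_apply X hxs,
    ← mpullbackWithin_extChartAt_symm_apply Y hxs]
  erw [← map_sub]
  exact congrArg L hbr

end Manifold

/-! ### Local coordinates on `E^* × ℝ` and its tangent vectors. -/

section DualLine

variable {B : Type*} [NormedAddCommGroup B] [NormedSpace ℝ B]
  {Q : Type*} [TopologicalSpace Q] [ChartedSpace B Q] [IsManifold 𝓘(ℝ, B) ∞ Q]
  {F : Type*} [NormedAddCommGroup F] [NormedSpace ℝ F]
  {E : Q → Type*} [∀ q, AddCommGroup (E q)] [∀ q, Module ℝ (E q)] [∀ q, TopologicalSpace (E q)]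
  [∀ q, IsTopologicalAddGroup (E q)] [∀ q, ContinuousSMul ℝ (E q)]
  [TopologicalSpace (TotalSpace F E)] [FiberBundle F E] [VectorBundle ℝ F E]
  [ContMDiffVectorBundle ∞ F E 𝓘(ℝ, B)]

/-- The fibre coordinates of a point of `E^* × ℝ` in the preferred trivialization at `q`. -/
def momentum (q : Q) (p : DualLine F E) : F →L[ℝ] ℝ :=
  (trivializationAt (F →L[ℝ] ℝ) (fun q ↦ E q →L[ℝ] ℝ) q p.1).2

/-- `E^*` is the hom bundle into the trivial line bundle, so its coordinates are precomposition with
the inverse trivialization of `E`. -/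
theorem momentum_apply (q : Q) {p : DualLine F E}
    (hp : p.1.proj ∈ (trivializationAt F E q).baseSet) (z : F) :
    momentum q p z = p.1.snd ((trivializationAt F E q).symm p.1.proj z) := by
  rw [momentum, hom_trivializationAt_apply]
  simp [ContinuousLinearMap.inCoordinates, Trivialization.symmL_apply (R := ℝ) _ hp]

theorem mem_baseSet_dual (q x : Q) :
    x ∈ (trivializationAt (F →L[ℝ] ℝ) (fun q ↦ E q →L[ℝ] ℝ) q).baseSet ↔
    x ∈ (trivializationAt F E q).baseSet := by
  rw [hom_trivializationAt_baseSet]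
  simp

theorem momentum_apply_trivializationAt (q : Q) {p : DualLine F E}
    (hp : p.1.proj ∈ (trivializationAt F E q).baseSet) (a : E p.1.proj) :
    momentum q p (trivializationAt F E q ⟨p.1.proj, a⟩).2 = p.1.snd a := by
  rw [momentum_apply q hp, Trivialization.symm_apply_apply_mk _ hp]

/-- The trivialization of `E^* × ℝ` induced by the preferred trivialization of `E` at `q`. -/
def toCoord (q : Q) (p : DualLine F E) : (Q × (F →L[ℝ] ℝ)) × ℝ :=
  ((p.1.proj, momentum q p), p.2)

/-- The local inverse of `toCoord q`. -/
def ofCoord (q : Q) (y : (Q × (F →L[ℝ] ℝ)) × ℝ) : DualLine F E :=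
  ((trivializationAt (F →L[ℝ] ℝ) (fun q ↦ E q →L[ℝ] ℝ) q).toOpenPartialHomeomorph.symm y.1, y.2)

variable (E) in
/-- The domain of `toCoord q`. -/
def coordSource (q : Q) : Set (DualLine F E) :=
  {p | p.1.proj ∈ (trivializationAt F E q).baseSet}

variable (F E) in
/-- The domain of `ofCoord q`. -/
def coordTarget (q : Q) : Set ((Q × (F →L[ℝ] ℝ)) × ℝ) :=
  {y | y.1.1 ∈ (trivializationAt F E q).baseSet}

theorem contMDiff_dualLineProj : ContMDiff (dualLineModel B F) 𝓘(ℝ, B) ∞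
    (dualLineProj : DualLine F E → Q) :=
  (contMDiff_proj (n := ∞) (fun q ↦ E q →L[ℝ] ℝ)).comp contMDiff_fst

theorem isOpen_coordSource (q : Q) : IsOpen (coordSource E q (F := F)) :=
  (trivializationAt F E q).open_baseSet.preimage
    ((FiberBundle.continuous_proj (F →L[ℝ] ℝ) (fun q ↦ E q →L[ℝ] ℝ)).comp continuous_fst)

theorem isOpen_coordTarget (q : Q) : IsOpen (coordTarget F E q) :=
  (trivializationAt F E q).open_baseSet.preimage (continuous_fst.comp continuous_fst)

theorem mem_coordSource_self (p : DualLine F E) : p ∈ coordSource E p.1.proj :=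
  FiberBundle.mem_baseSet_trivializationAt' p.1.proj

theorem ofCoord_toCoord (q : Q) {p : DualLine F E} (hp : p ∈ coordSource E q) :
    ofCoord q (toCoord q p) = p := by
  set e := trivializationAt (F →L[ℝ] ℝ) (fun q ↦ E q →L[ℝ] ℝ) q with he
  have hs : p.1 ∈ e.source := e.mem_source.2 ((mem_baseSet_dual q _).2 hp)
  have h : (p.1.proj, momentum q p) = e p.1 := Prod.ext (e.coe_fst hs).symm rfl
  refine Prod.ext ?_ rfl
  change e.toOpenPartialHomeomorph.symm (p.1.proj, momentum q p) = p.1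
  rw [h]
  exact e.toOpenPartialHomeomorph.left_inv hs

theorem dualLineProj_ofCoord (q : Q) {y : (Q × (F →L[ℝ] ℝ)) × ℝ} (hy : y ∈ coordTarget F E q) :
    dualLineProj (ofCoord q y : DualLine F E) = y.1.1 :=
  (trivializationAt (F →L[ℝ] ℝ) (fun q ↦ E q →L[ℝ] ℝ) q).proj_symm_apply'
    ((mem_baseSet_dual q _).2 hy)

theorem contMDiffOn_momentum (q : Q) : ContMDiffOn (dualLineModel B F) 𝓘(ℝ, F →L[ℝ] ℝ) ∞
    (momentum q : DualLine F E → _) (coordSource E q) := by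
  have h := (trivializationAt (F →L[ℝ] ℝ) (fun q ↦ E q →L[ℝ] ℝ) q).contMDiffOn (n := ∞)
    (IB := 𝓘(ℝ, B))
  exact contMDiff_snd.comp_contMDiffOn (h.comp contMDiff_fst.contMDiffOn fun p hp ↦
    (Trivialization.mem_source _).2 ((mem_baseSet_dual q _).2 hp))

theorem contMDiffOn_toCoord (q : Q) : ContMDiffOn (dualLineModel B F) (dualLineModel B F) ∞
    (toCoord q : DualLine F E → _) (coordSource E q) :=
  (contMDiff_dualLineProj.contMDiffOn.prodMk (contMDiffOn_momentum q)).prodMk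
    contMDiff_snd.contMDiffOn

theorem contMDiffOn_ofCoord (q : Q) : ContMDiffOn (dualLineModel B F) (dualLineModel B F) ∞
    (ofCoord q : _ → DualLine F E) (coordTarget F E q) := by
  have h := (trivializationAt (F →L[ℝ] ℝ) (fun q ↦ E q →L[ℝ] ℝ) q).contMDiffOn_symm (n := ∞)
    (IB := 𝓘(ℝ, B))
  exact (h.comp contMDiff_fst.contMDiffOn fun y hy ↦
    (Trivialization.mem_target _).2 ((mem_baseSet_dual q _).2 hy)).prodMk contMDiff_snd.contMDiffOn

theorem mdifferentiableAt_momentum (q : Q) {p : DualLine F E} (hp : p ∈ coordSource E q) :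
    MDifferentiableAt (dualLineModel B F) 𝓘(ℝ, F →L[ℝ] ℝ) (momentum q) p :=
  ((contMDiffOn_momentum q).contMDiffAt ((isOpen_coordSource q).mem_nhds hp)).mdifferentiableAt
    (by simp)

theorem mdifferentiableAt_ofCoord (q : Q)
    {y : (Q × (F →L[ℝ] ℝ)) × ℝ} (hy : y ∈ coordTarget F E q) :
    MDifferentiableAt (dualLineModel B F) (dualLineModel B F) (ofCoord q : _ → DualLine F E) y :=
  ((contMDiffOn_ofCoord q).contMDiffAt ((isOpen_coordTarget q).mem_nhds hy)).mdifferentiableAt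
    (by simp)

theorem mdifferentiableAt_dualLineProj (p : DualLine F E) :
    MDifferentiableAt (dualLineModel B F) 𝓘(ℝ, B) (dualLineProj : DualLine F E → Q) p :=
  contMDiff_dualLineProj.mdifferentiable (by simp) p

theorem mfderiv_toCoord_apply (q : Q) {p : DualLine F E} (hp : p ∈ coordSource E q)
    (v : TangentSpace (dualLineModel B F) p) :
    mfderiv (dualLineModel B F) (dualLineModel B F) (toCoord q) p v =
      ((mfderiv (dualLineModel B F) 𝓘(ℝ, B) (dualLineProj : DualLine F E → Q) p v,
        dirDeriv (dualLineModel B F) (momentum q) p v),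
        dirDeriv (dualLineModel B F) (fun p' : DualLine F E ↦ p'.2) p v) := by
  have h₁ := (mdifferentiableAt_dualLineProj (B := B) p).hasMFDerivAt.prodMk
    (mdifferentiableAt_momentum q hp).hasMFDerivAt
  have h₂ : MDifferentiableAt (dualLineModel B F) 𝓘(ℝ, ℝ) (fun p' : DualLine F E ↦ p'.2) p :=
    mdifferentiableAt_snd
  exact DFunLike.congr_fun (h₁.prodMk h₂.hasMFDerivAt).mfderiv v

/-- Chain rule for `ofCoord q ∘ toCoord q = id` near `p`. The left side is formally tangent at
`ofCoord q (toCoord q p)`, so the comparison is made in the model space. -/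
theorem mfderiv_ofCoord_mfderiv_toCoord (q : Q) {p : DualLine F E} (hp : p ∈ coordSource E q)
    (v : TangentSpace (dualLineModel B F) p) :
    (mfderiv (dualLineModel B F) (dualLineModel B F) (ofCoord q : _ → DualLine F E) (toCoord q p)
      (mfderiv (dualLineModel B F) (dualLineModel B F) (toCoord q) p v) :
        (B × (F →L[ℝ] ℝ)) × ℝ) = v := by
  have h₁ : MDifferentiableAt (dualLineModel B F) (dualLineModel B F) (toCoord q) p :=
    ((contMDiffOn_toCoord q).contMDiffAt ((isOpen_coordSource q).mem_nhds hp)).mdifferentiableAt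
      (by simp)
  have h₂ : MDifferentiableAt (dualLineModel B F) (dualLineModel B F)
      (ofCoord q : _ → DualLine F E) (toCoord q p) := mdifferentiableAt_ofCoord q hp
  have h : (ofCoord q ∘ toCoord q : DualLine F E → DualLine F E) =ᶠ[𝓝 p] id := by
    filter_upwards [(isOpen_coordSource q).mem_nhds hp] with p' hp'
    exact ofCoord_toCoord q hp'
  have h₃ := (h₂.hasMFDerivAt.comp p h₁.hasMFDerivAt).congr_of_eventuallyEq h.symm
  have h₄ := hasMFDerivAt_unique h₃ (hasMFDerivAt_id p)
  exact DFunLike.congr_fun h₄ v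

/-- A tangent vector of `E^* × ℝ` is determined by its components in a trivialization. -/
theorem tangent_dualLine_ext (q : Q) {p : DualLine F E} (hp : p ∈ coordSource E q)
    {v w : TangentSpace (dualLineModel B F) p}
    (h₁ : mfderiv (dualLineModel B F) 𝓘(ℝ, B) (dualLineProj : DualLine F E → Q) p v =
      mfderiv (dualLineModel B F) 𝓘(ℝ, B) (dualLineProj : DualLine F E → Q) p w)
    (h₂ : dirDeriv (dualLineModel B F) (momentum q) p v =
      dirDeriv (dualLineModel B F) (momentum q) p w)
    (h₃ : dirDeriv (dualLineModel B F) (fun p' : DualLine F E ↦ p'.2) p v =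
      dirDeriv (dualLineModel B F) (fun p' : DualLine F E ↦ p'.2) p w) : v = w := by
  rw [← mfderiv_ofCoord_mfderiv_toCoord q hp v, ← mfderiv_ofCoord_mfderiv_toCoord q hp w,
    mfderiv_toCoord_apply q hp, mfderiv_toCoord_apply q hp, h₁, h₂, h₃]

theorem mfderiv_dualLineProj_ofCoord (q : Q) {p : DualLine F E} (hp : p ∈ coordSource E q)
    (u : (B × (F →L[ℝ] ℝ)) × ℝ) :
    mfderiv (dualLineModel B F) 𝓘(ℝ, B) (dualLineProj : DualLine F E → Q) p
      (mfderiv (dualLineModel B F) (dualLineModel B F) (ofCoord q : _ → DualLine F E)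
        (toCoord q p) u : (B × (F →L[ℝ] ℝ)) × ℝ) = u.1.1 := by
  have hy : toCoord q p ∈ coordTarget F E q := hp
  have h : (fun y ↦ y.1.1) =ᶠ[𝓝 (toCoord q p)]
      (dualLineProj : DualLine F E → Q) ∘ (ofCoord q : _ → DualLine F E) := by
    filter_upwards [(isOpen_coordTarget q).mem_nhds hy] with y hy'
    exact (dualLineProj_ofCoord q hy').symm
  have hd : HasMFDerivAt (dualLineModel B F) 𝓘(ℝ, B) (dualLineProj : DualLine F E → Q)
      (ofCoord q (toCoord q p)) (mfderiv (dualLineModel B F) 𝓘(ℝ, B)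
        (dualLineProj : DualLine F E → Q) p) := by
    rw [ofCoord_toCoord q hp]
    exact (mdifferentiableAt_dualLineProj p).hasMFDerivAt
  have h₁ := (hd.comp _ (mdifferentiableAt_ofCoord q hy).hasMFDerivAt).congr_of_eventuallyEq h
  have h₂ : HasMFDerivAt (dualLineModel B F) 𝓘(ℝ, B)
      (fun y : (Q × (F →L[ℝ] ℝ)) × ℝ ↦ y.1.1) (toCoord q p) _ :=
    (hasMFDerivAt_fst (I := 𝓘(ℝ, B)) (I' := 𝓘(ℝ, F →L[ℝ] ℝ)) (toCoord q p).1).comp _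
      (hasMFDerivAt_fst _)
  exact DFunLike.congr_fun (hasMFDerivAt_unique h₁ h₂) u

/-- The vector field on the domain of `toCoord q` whose components in the trivialization are
`V ∘ π`, for a vector field `V` on `Q`, and constants `β₀`, `s₀`. -/
def liftField (V : ∀ x : Q, TangentSpace 𝓘(ℝ, B) x) (q : Q) (β₀ : F →L[ℝ] ℝ) (s₀ : ℝ)
    (p : DualLine F E) : TangentSpace (dualLineModel B F) p :=
  (mfderiv (dualLineModel B F) (dualLineModel B F) (ofCoord q : _ → DualLine F E) (toCoord q p)
    ((V p.1.proj, β₀), s₀) : (B × (F →L[ℝ] ℝ)) × ℝ)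

/-- The field is the tangent map of `ofCoord q` applied to a smooth map into the tangent bundle of
the coordinate product, assembled factor by factor. -/
theorem contMDiffOn_liftField (V : ∀ x : Q, TangentSpace 𝓘(ℝ, B) x)
    (hV : ContMDiff 𝓘(ℝ, B) 𝓘(ℝ, B).tangent ∞ (fun x ↦ (⟨x, V x⟩ : TangentBundle 𝓘(ℝ, B) Q)))
    (q : Q) (β₀ : F →L[ℝ] ℝ) (s₀ : ℝ) :
    ContMDiffOn (dualLineModel B F) (dualLineModel B F).tangent ∞
      (fun p ↦ (⟨p, liftField V q β₀ s₀ p⟩ : TangentBundle (dualLineModel B F) (DualLine F E)))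
      (coordSource E q) := by
  have h₁ : ContMDiffOn (dualLineModel B F) 𝓘(ℝ, B).tangent ∞
      (fun p : DualLine F E ↦ (⟨p.1.proj, V p.1.proj⟩ : TangentBundle 𝓘(ℝ, B) Q))
      (coordSource E q) := (hV.comp contMDiff_dualLineProj).contMDiffOn
  have h₂ : ContMDiffOn (dualLineModel B F) 𝓘(ℝ, F →L[ℝ] ℝ).tangent ∞
      (fun p : DualLine F E ↦ (⟨momentum q p, β₀⟩ : TangentBundle 𝓘(ℝ, F →L[ℝ] ℝ) (F →L[ℝ] ℝ)))
      (coordSource E q) :=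
    (contMDiff_vectorSpace_iff_contDiff (V := fun _ ↦ β₀) |>.2 contDiff_const).comp_contMDiffOn
      (contMDiffOn_momentum q)
  have h₃ : ContMDiffOn (dualLineModel B F) 𝓘(ℝ, ℝ).tangent ∞
      (fun p : DualLine F E ↦ (⟨p.2, s₀⟩ : TangentBundle 𝓘(ℝ, ℝ) ℝ)) (coordSource E q) :=
    (contMDiff_vectorSpace_iff_contDiff (V := fun _ ↦ s₀) |>.2 contDiff_const).comp_contMDiffOn
      contMDiff_snd.contMDiffOn
  have h₄ := contMDiff_equivTangentBundleProd_symm.comp_contMDiffOn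
    ((contMDiff_equivTangentBundleProd_symm.comp_contMDiffOn (h₁.prodMk h₂)).prodMk h₃)
  have h₅ := (contMDiffOn_ofCoord (B := B) (F := F) (E := E) q).contMDiffOn_tangentMapWithin (m := ∞)
    (by simp) (isOpen_coordTarget q).uniqueMDiffOn
  refine (h₅.comp h₄ fun p hp ↦ hp).congr fun p hp ↦ ?_
  have hy : toCoord q p ∈ coordTarget F E q := hp
  have key : ∀ p' : DualLine F E, p' = p → ∀ v : (B × (F →L[ℝ] ℝ)) × ℝ,
      (⟨p, v⟩ : TangentBundle (dualLineModel B F) (DualLine F E)) = ⟨p', v⟩ := by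
    rintro _ rfl v; rfl
  refine (key _ (ofCoord_toCoord q hp) _).trans ?_
  let u : (B × (F →L[ℝ] ℝ)) × ℝ := ((V p.1.proj, β₀), s₀)
  exact (tangentMapWithin_eq_tangentMap (p := ⟨toCoord q p, u⟩)
    ((isOpen_coordTarget q).uniqueMDiffOn _ hy) (mdifferentiableAt_ofCoord q hy)).symm

/-! ### Global sections of the prolongation and a pointwise formula for `dη`. -/

variable [FiniteDimensional ℝ B] [T2Space Q]

theorem constSection_eventually_eq (q : Q) (a : E q) :
    ∀ᶠ x in 𝓝 q, (constSection (B := B) (F := F) q a) x =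
      (trivializationAt F E q).symm x ((trivializationAt F E q) ⟨q, a⟩).2 :=
  (exists_constSection (B := B) (F := F) q a).choose_spec

@[simp]
theorem constSection_self (q : Q) (a : E q) : constSection (B := B) (F := F) q a q = a := by
  rw [(constSection_eventually_eq q a).self_of_nhds, Trivialization.symm_apply_apply_mk]
  exact FiberBundle.mem_baseSet_trivializationAt' q

variable (A : LieAlgebroid B F E)

/-- Every element of the prolongation extends to a global smooth section. -/
theorem exists_hamSection (p : DualLine F E) (z : HamFiber A p) :
    ∃ Z : HamSection A, Z.toFun p = z := by
  set q := p.1.proj with hq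
  have hqs : (trivializationAt F E q).baseSet ∈ 𝓝 q :=
    (trivializationAt F E q).open_baseSet.mem_nhds (FiberBundle.mem_baseSet_trivializationAt' q)
  -- One cutoff pulled back from `Q` multiplies both components, so `ρ(a) = Tπ(v)` survives by
  -- linearity; outside the trivialized region both sides vanish.
  obtain ⟨χ, -, hχ⟩ := (SmoothBumpFunction.nhds_basis_tsupport (I := 𝓘(ℝ, B)) q).mem_iff.1 hqs
  let σ : Cₛ^∞⟮𝓘(ℝ, B); F, E⟯ := constSection q z.1.1
  let V : ∀ x : Q, TangentSpace 𝓘(ℝ, B) x := fun x ↦ A.anchor x (σ x)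
  let β₀ : F →L[ℝ] ℝ := dirDeriv (dualLineModel B F) (momentum q) p z.1.2
  let s₀ : ℝ := dirDeriv (dualLineModel B F) (fun p' : DualLine F E ↦ p'.2) p z.1.2
  have hψ : ContMDiff (dualLineModel B F) 𝓘(ℝ, ℝ) ∞ (fun p' : DualLine F E ↦ χ p'.1.proj) :=
    χ.contMDiff.comp contMDiff_dualLineProj
  have hsupp : tsupport (fun p' : DualLine F E ↦ χ p'.1.proj) ⊆ coordSource E q := by
    refine Subset.trans (closure_minimal (t := dualLineProj ⁻¹' tsupport χ) ?_ ?_)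
      (preimage_mono hχ)
    · exact preimage_mono (subset_tsupport χ)
    · exact (isClosed_tsupport χ).preimage (contMDiff_dualLineProj (B := B)).continuous
  have hX := contMDiffOn_liftField (E := E) V (A.contMDiff_anchor.comp σ.contMDiff) q β₀ s₀
  have hp := mem_coordSource_self p
  let Z : HamSection A :=
    { toFun := fun p' ↦ ⟨(χ p'.1.proj • σ p'.1.proj, χ p'.1.proj • liftField V q β₀ s₀ p'), by
        let T := mfderiv (dualLineModel B F) 𝓘(ℝ, B) (dualLineProj : DualLine F E → Q) p'
        change A.anchor p'.1.proj (χ p'.1.proj • σ p'.1.proj) =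
          T (χ p'.1.proj • liftField V q β₀ s₀ p')
        refine (map_smul (A.anchor p'.1.proj) _ _).trans (Eq.trans ?_ (T.map_smul _ _).symm)
        by_cases h : p' ∈ coordSource E q
        · let u : (B × (F →L[ℝ] ℝ)) × ℝ := ((V p'.1.proj, β₀), s₀)
          exact congrArg (χ p'.1.proj • ·) (mfderiv_dualLineProj_ofCoord (E := E) q h u).symm
        · have h0 : χ p'.1.proj = 0 := image_eq_zero_of_notMem_tsupport fun h' ↦ h (hχ h')
          rw [h0, zero_smul, zero_smul]⟩
      contMDiff_fst := (χ.contMDiff.smul_section σ.contMDiff).comp contMDiff_dualLineProj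
      contMDiff_snd := ContMDiffOn.smul_section_of_tsupport hψ.contMDiffOn
        (isOpen_coordSource q) hsupp hX }
  refine ⟨Z, Subtype.ext (Prod.ext ?_ ?_)⟩
  · change χ q • σ q = _
    rw [χ.eq_one, one_smul]
    exact constSection_self q _
  · change χ q • liftField V q β₀ s₀ p = _
    rw [χ.eq_one, one_smul]
    refine Eq.trans ?_ (mfderiv_ofCoord_mfderiv_toCoord q hp z.1.2)
    rw [mfderiv_toCoord_apply q hp]
    have h : V q = mfderiv (dualLineModel B F) 𝓘(ℝ, B) (dualLineProj : DualLine F E → Q) p z.1.2 := by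
      rw [← z.2]
      exact congrArg _ (constSection_self q _)
    rw [← h]
    rfl

variable {A}

theorem contactForm_apply (p : DualLine F E) (a : E p.1.proj)
    (v : TangentSpace (dualLineModel B F) p) :
    contactForm B p (a, v) =
      dirDeriv (dualLineModel B F) (fun p' : DualLine F E ↦ p'.2) p v - p.1.snd a := rfl

/-- The differential of the contact form in a trivialization. -/
theorem extDerivOne_contactForm (Z₁ Z₂ : HamSection A) (p : DualLine F E) :
    extDerivOne (contactForm B) Z₁ Z₂ p =
      dirDeriv (dualLineModel B F) (momentum p.1.proj) p (Z₂.vec p)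
        (trivializationAt F E p.1.proj ⟨p.1.proj, Z₁.fst p⟩).2
      - dirDeriv (dualLineModel B F) (momentum p.1.proj) p (Z₁.vec p)
        (trivializationAt F E p.1.proj ⟨p.1.proj, Z₂.fst p⟩).2
      + p.1.snd (A.bracket (constSection p.1.proj (Z₁.fst p)) (constSection p.1.proj (Z₂.fst p))
        p.1.proj) := by
  set q := p.1.proj with hq
  have hp : p ∈ coordSource E q := mem_coordSource_self p
  have hvec : ∀ Z : HamSection A, MDifferentiableAt (dualLineModel B F) (dualLineModel B F).tangent
      (fun p ↦ (⟨p, Z.vec p⟩ : TangentBundle (dualLineModel B F) (DualLine F E))) p := fun Z ↦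
    Z.contMDiff_snd.mdifferentiable (by simp) p
  have hds : ∀ Z : HamSection A, MDifferentiableAt (dualLineModel B F) 𝓘(ℝ, ℝ)
      (fun p' ↦ dirDeriv (dualLineModel B F) (fun p' : DualLine F E ↦ p'.2) p' (Z.vec p')) p := by
    intro Z
    have h : ContMDiff (dualLineModel B F) 𝓘(ℝ, ℝ) ∞ (fun p' : DualLine F E ↦ p'.2) :=
      contMDiff_snd
    have h' := (contMDiff_snd_tangentBundle_modelSpace (E := ℝ) (I := 𝓘(ℝ, ℝ)) (n := ∞)).comp
      ((h.contMDiff_tangentMap (m := ∞) (by simp)).comp Z.contMDiff_snd)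
    exact h'.mdifferentiable (by simp) p
  let c (Z : HamSection A) (p' : DualLine F E) : F :=
    (trivializationAt F E q ⟨p'.1.proj, Z.fst p'⟩).2
  have hc : ∀ Z : HamSection A, MDifferentiableAt (dualLineModel B F) 𝓘(ℝ, F) (c Z) p := by
    intro Z
    have h := (trivializationAt F E q).contMDiffOn (n := ∞) (IB := 𝓘(ℝ, B))
    have h' := contMDiff_snd.comp_contMDiffOn (h.comp (Z.contMDiff_fst.contMDiffOn
      (s := coordSource E q)) fun p hp ↦ (Trivialization.mem_source _).2 hp)
    exact (h'.contMDiffAt ((isOpen_coordSource q).mem_nhds hp)).mdifferentiableAt (by simp)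
  -- Product rule for `η(Z) = ds(Z) - ⟨momentum, c Z⟩`. The `derivFst` terms will cancel those in
  -- `prolBracket`, leaving an expression in the values of `Z₁`, `Z₂` at `p` alone.
  have hη : ∀ (Z : HamSection A) (v : TangentSpace (dualLineModel B F) p),
      dirDeriv (dualLineModel B F) (fun p' ↦ contactForm B p' (Z.toFun p')) p v =
        dirDeriv (dualLineModel B F) (fun p' ↦ dirDeriv (dualLineModel B F)
          (fun p' : DualLine F E ↦ p'.2) p' (Z.vec p')) p v
        - (dirDeriv (dualLineModel B F) (momentum q) p v (c Z p) + p.1.snd (Z.derivFst p v)) := by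
    intro Z v
    have he : (fun p' ↦ contactForm B p' (Z.toFun p')) =ᶠ[𝓝 p]
        fun p' ↦ dirDeriv (dualLineModel B F) (fun p' : DualLine F E ↦ p'.2) p' (Z.vec p')
          - momentum q p' (c Z p') := by
      filter_upwards [(isOpen_coordSource q).mem_nhds hp] with p' hp'
      rw [momentum_apply_trivializationAt q hp']
      rfl
    have hm := mdifferentiableAt_momentum (B := B) q hp
    have hpair : HasMFDerivAt (dualLineModel B F) 𝓘(ℝ, (F →L[ℝ] ℝ) × F)
        (fun p' ↦ (momentum q p', c Z p')) p
        ((mfderiv (dualLineModel B F) 𝓘(ℝ, F →L[ℝ] ℝ) (momentum q) p).prod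
          (mfderiv (dualLineModel B F) 𝓘(ℝ, F) (c Z) p)) :=
      ⟨hm.hasMFDerivAt.1.prodMk (hc Z).hasMFDerivAt.1,
        hm.hasMFDerivAt.2.prodMk (hc Z).hasMFDerivAt.2⟩
    have hbil : HasMFDerivAt 𝓘(ℝ, (F →L[ℝ] ℝ) × F) 𝓘(ℝ, ℝ)
      (fun y : (F →L[ℝ] ℝ) × F ↦ y.1 y.2) (momentum q p, c Z p) _ :=
        (hasFDerivAt_fst.clm_apply hasFDerivAt_snd).hasMFDerivAt
    have h := (hds Z).hasMFDerivAt.sub (hbil.comp p hpair)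
    rw [dirDeriv, he.mfderiv_eq]
    refine (DFunLike.congr_fun h.mfderiv v).trans ?_
    have hd : p.1.snd (Z.derivFst p v) = momentum q p (dirDeriv (dualLineModel B F) (c Z) p v) :=
      (momentum_apply q hp _).symm
    rw [hd]
    change _ - (momentum q p (dirDeriv (dualLineModel B F) (c Z) p v)
      + dirDeriv (dualLineModel B F) (momentum q) p v (c Z p)) = _
    rw [add_comm (momentum q p _)]
    rfl
  -- The coordinate `s` is linear in the chart, so the bracket lemma applies and all iterated
  -- derivatives of `s` cancel.
  have hbr := dirDeriv_mlieBracket_of_eventuallyEq_extChartAt (I := dualLineModel B F)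
    (ContinuousLinearMap.snd ℝ (B × (F →L[ℝ] ℝ)) ℝ) (fun p' : DualLine F E ↦ p'.2) p
    (Eventually.of_forall fun p' ↦ rfl) Z₁.vec Z₂.vec (hvec Z₁) (hvec Z₂)
  rw [extDerivOne, hη, hη, prolBracket, contactForm_apply, hbr, map_sub, map_add]
  ring

/-! ### Isotropy of `F_γ` for `dη`. -/

section Gamma

variable (γ₀ : Cₛ^∞⟮𝓘(ℝ, B); F →L[ℝ] ℝ, fun q ↦ E q →L[ℝ] ℝ⟯)
  (γₛ : C^∞⟮𝓘(ℝ, B), Q; 𝓘(ℝ, ℝ), ℝ⟯)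

theorem dirDeriv_gammaMap {W : Type*} [NormedAddCommGroup W] [NormedSpace ℝ W]
    (g : DualLine F E → W) (q : Q) (u : TangentSpace 𝓘(ℝ, B) q)
    (hg : MDifferentiableAt (dualLineModel B F) 𝓘(ℝ, W) g (gammaMap γ₀ γₛ q)) :
    dirDeriv (dualLineModel B F) g (gammaMap γ₀ γₛ q)
      (mfderiv 𝓘(ℝ, B) (dualLineModel B F) (gammaMap γ₀ γₛ) q u) =
      dirDeriv 𝓘(ℝ, B) (g ∘ gammaMap γ₀ γₛ) q u :=
  (DFunLike.congr_fun (mfderiv_comp q hg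
    ((contMDiff_gammaMap γ₀ γₛ).mdifferentiable (by simp) q)) u).symm

variable {γ₀ γₛ}

/-- Near `q`, `constSection q a` has constant coefficients, so pairing them with the momentum along
`γ` gives `γ₀(constSection q a)`, which is `ρ(constSection q a) γₛ` by `h`. This rewrites `dη` on
`F_γ` through second derivatives of `γₛ`. -/
theorem dirDeriv_momentum_gammaMap
    (h : ∀ q (a : E q), γ₀ q a = dirDeriv 𝓘(ℝ, B) γₛ q (A.anchor q a))
    (q : Q) (u : TangentSpace 𝓘(ℝ, B) q) (a : E q) :
    dirDeriv (dualLineModel B F) (momentum q) (gammaMap γ₀ γₛ q)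
      (mfderiv 𝓘(ℝ, B) (dualLineModel B F) (gammaMap γ₀ γₛ) q u)
        (trivializationAt F E q ⟨q, a⟩).2 =
      dirDeriv 𝓘(ℝ, B) (A.lieDeriv (constSection q a) γₛ) q u := by
  have hp : gammaMap γ₀ γₛ q ∈ coordSource E q := FiberBundle.mem_baseSet_trivializationAt' q
  have hm := mdifferentiableAt_momentum (B := B) q hp
  rw [dirDeriv_gammaMap γ₀ γₛ _ q u hm]
  have hcomp := hm.comp q ((contMDiff_gammaMap γ₀ γₛ).mdifferentiable (by simp) q)
  set L := ContinuousLinearMap.apply ℝ ℝ (trivializationAt F E q ⟨q, a⟩).2 with hL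
  have h₁ : L ∘ (momentum q ∘ gammaMap γ₀ γₛ) =ᶠ[𝓝 q] A.lieDeriv (constSection q a) γₛ := by
    filter_upwards [constSection_eventually_eq (B := B) (F := F) q a,
      (trivializationAt F E q).open_baseSet.mem_nhds
        (FiberBundle.mem_baseSet_trivializationAt' q)] with x hx hxs
    have h₂ : momentum q (gammaMap γ₀ γₛ x) (trivializationAt F E q ⟨q, a⟩).2 =
      γ₀ x ((trivializationAt F E q).symm x ((trivializationAt F E q) ⟨q, a⟩).2) :=
      momentum_apply q (p := gammaMap γ₀ γₛ x) hxs _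
    refine h₂.trans ?_
    rw [← hx, h]
    rfl
  have h₃ := (L.hasFDerivAt (x := momentum q (gammaMap γ₀ γₛ q))).hasMFDerivAt.comp q
    hcomp.hasMFDerivAt
  have h₄ := (h₃.congr_of_eventuallyEq h₁.symm).mfderiv
  exact (DFunLike.congr_fun h₄ u).symm

/-- The differential of the contact form vanishes on a Legendrian `F_γ`. -/
theorem extDeriv_gammaLift_eq_zero
    (h : ∀ q (a : E q), γ₀ q a = dirDeriv 𝓘(ℝ, B) γₛ q (A.anchor q a)) (q : Q) (a a' : E q) :
    dirDeriv (dualLineModel B F) (momentum q) (gammaMap γ₀ γₛ q)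
      (mfderiv 𝓘(ℝ, B) (dualLineModel B F) (gammaMap γ₀ γₛ) q (A.anchor q a'))
        (trivializationAt F E q ⟨q, a⟩).2
    - dirDeriv (dualLineModel B F) (momentum q) (gammaMap γ₀ γₛ q)
      (mfderiv 𝓘(ℝ, B) (dualLineModel B F) (gammaMap γ₀ γₛ) q (A.anchor q a))
        (trivializationAt F E q ⟨q, a'⟩).2
    + γ₀ q (A.bracket (constSection q a) (constSection q a') q) = 0 := by
  rw [dirDeriv_momentum_gammaMap h, dirDeriv_momentum_gammaMap h]
  -- Compatibility of the anchor with brackets needs a section nonzero at `q`; in a zero fibre every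
  -- term vanishes.
  by_cases h0 : ∀ b : E q, b = 0
  · rw [h0 (A.bracket _ _ q), h0 a, h0 a', map_zero, map_zero, sub_self, add_zero]
  · push Not at h0
    obtain ⟨b, hb⟩ := h0
    rw [h, A.dirDeriv_anchor_bracket _ _ (constSection q b) _ _ (by rwa [constSection_self]),
      constSection_self, constSection_self]
    ring

end Gamma

end DualLine

end ContactAlgebroid

end

/-! ### The Hamilton–Jacobi theorem. -/

open ContactAlgebroid in
theorem mainTheorem7
    {B : Type*} [NormedAddCommGroup B] [NormedSpace ℝ B] [FiniteDimensional ℝ B]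
    {Q : Type*} [TopologicalSpace Q] [T2Space Q] [ChartedSpace B Q] [IsManifold 𝓘(ℝ, B) ∞ Q]
    {F : Type*} [NormedAddCommGroup F] [NormedSpace ℝ F] [FiniteDimensional ℝ F]
    {E : Q → Type*} [∀ q, AddCommGroup (E q)] [∀ q, Module ℝ (E q)] [∀ q, TopologicalSpace (E q)]
    [∀ q, IsTopologicalAddGroup (E q)] [∀ q, ContinuousSMul ℝ (E q)]
    [TopologicalSpace (TotalSpace F E)] [FiberBundle F E] [VectorBundle ℝ F E]
    [ContMDiffVectorBundle ∞ F E 𝓘(ℝ, B)]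
    (A : LieAlgebroid B F E)
    (H : DualLine F E → ℝ) (hH : ContMDiff (dualLineModel B F) 𝓘(ℝ, ℝ) ∞ H)
    (R : HamSection A) (hR : IsReebSection R)
    (ξ : HamSection A) (hξ : IsHamiltonianSection R H ξ)
    (γ₀ : Cₛ^∞⟮𝓘(ℝ, B); F →L[ℝ] ℝ, fun q ↦ E q →L[ℝ] ℝ⟯)
    (γₛ : C^∞⟮𝓘(ℝ, B), Q; 𝓘(ℝ, ℝ), ℝ⟯)
    (hγ : IsLegendrian A (contactForm B) (gammaMap γ₀ γₛ) (gammaSub A γ₀ γₛ)) :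
    IsLocallyOneJet A γ₀ γₛ ∧
      (GammaRelated γ₀ γₛ ξ (inducedSection γ₀ γₛ ξ) ↔ ∀ q : Q, H (gammaMap γ₀ γₛ q) = 0) := by
  have hη : ∀ q (a : E q), contactForm B (gammaMap γ₀ γₛ q) (gammaLift A γ₀ γₛ q a) = 0 :=
    fun q a ↦ (hγ q).2 _ ⟨a, rfl⟩
  have hds : ∀ q (u : TangentSpace 𝓘(ℝ, B) q),
      dirDeriv (dualLineModel B F) (fun p' : DualLine F E ↦ p'.2) (gammaMap γ₀ γₛ q)
        (mfderiv 𝓘(ℝ, B) (dualLineModel B F) (gammaMap γ₀ γₛ) q u) = dirDeriv 𝓘(ℝ, B) γₛ q u :=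
    fun q u ↦ dirDeriv_gammaMap γ₀ γₛ _ q u mdifferentiableAt_snd
  have hjet : ∀ q (a : E q), γ₀ q a = dirDeriv 𝓘(ℝ, B) γₛ q (A.anchor q a) := by
    intro q a
    rw [← hds]
    exact (sub_eq_zero.1 (hη q a)).symm
  refine ⟨fun q₀ ↦ ⟨univ, γₛ, isOpen_univ, mem_univ _, γₛ.contMDiff.contMDiffOn, fun q _ ↦
    ⟨rfl, hjet q⟩⟩, fun hrel q ↦ ?_, fun hHJ q ↦ ?_⟩
  · have h := hξ.contactForm_eq (gammaMap γ₀ γₛ q)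
    rw [hrel q, hη] at h
    exact neg_eq_zero.1 h.symm
  have hp : gammaMap γ₀ γₛ q ∈ coordSource E q := FiberBundle.mem_baseSet_trivializationAt' q
  set a : E q := ξ.fst (gammaMap γ₀ γₛ q) with ha
  refine Subtype.ext (Prod.ext rfl ?_)
  change ξ.vec (gammaMap γ₀ γₛ q) =
    mfderiv 𝓘(ℝ, B) (dualLineModel B F) (gammaMap γ₀ γₛ) q (A.anchor q a)
  -- The base component agrees by the prolongation condition, the momentum component by `dη`, and
  -- the `s` component by `η`.
  refine tangent_dualLine_ext q hp ?_ ?_ ?_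
  · exact (ξ.toFun (gammaMap γ₀ γₛ q)).2.symm.trans (mfderiv_proj_gammaMap γ₀ γₛ q _).symm
  · ext z
    set e := trivializationAt F E q with he
    have hz : (e ⟨q, e.symm q z⟩).2 = z := by
      rw [e.apply_mk_symm (FiberBundle.mem_baseSet_trivializationAt' q)]
    set a' : E q := e.symm q z with ha'
    -- The Hamiltonian equation is stated for sections, so the test vector in `F_γ` must be extended
    -- to one.
    obtain ⟨Z, hZ⟩ := exists_hamSection A (gammaMap γ₀ γₛ q) (gammaLift A γ₀ γₛ q a')
    have hfst : Z.fst (gammaMap γ₀ γₛ q) = a' := by rw [ProlSection.fst, hZ]; rfl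
    have hvec : Z.vec (gammaMap γ₀ γₛ q) =
        mfderiv 𝓘(ℝ, B) (dualLineModel B F) (gammaMap γ₀ γₛ) q (A.anchor q a') := by
      rw [ProlSection.vec, hZ]; rfl
    have h₁ := hξ.extDeriv_eq Z (gammaMap γ₀ γₛ q)
    have h₂ : dirDeriv 𝓘(ℝ, B) (H ∘ gammaMap γ₀ γₛ) q (A.anchor q a') = 0 := by
      have : H ∘ gammaMap γ₀ γₛ = fun _ ↦ 0 := funext hHJ
      rw [this, dirDeriv, mfderiv_const]
      rfl
    rw [hZ, hη, hvec, dirDeriv_gammaMap γ₀ γₛ H q _ (hH.mdifferentiable (by simp) _), h₂,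
      mul_zero, sub_zero, extDerivOne_contactForm, hvec, hfst] at h₁
    -- `h₁` and `h₃` share the bracket term and the term differentiating along `ρ(a')`; their
    -- difference compares the two momentum components at `a'`.
    have h₃ := extDeriv_gammaLift_eq_zero hjet q a a'
    rw [← hz]
    change dirDeriv (dualLineModel B F) (momentum q) (gammaMap γ₀ γₛ q) _ (e ⟨q, a⟩).2
      - dirDeriv (dualLineModel B F) (momentum q) (gammaMap γ₀ γₛ q) _ (e ⟨q, a'⟩).2
      + γ₀ q (A.bracket (constSection q a) (constSection q a') q) = 0 at h₁
    linarith
  · rw [hds, ← hjet]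
    have h := hξ.contactForm_eq (gammaMap γ₀ γₛ q)
    rw [hHJ, neg_zero] at h
    exact sub_eq_zero.1 h
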